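/- Let $\mathcal{P}_t=e^{t\mathcal{L}}$, $t\ge 0$, be a quantum Markov semigroup on $\mathbb{M}_n(\mathbb{C})$ (a continuous semigroup of unital completely positive maps), GNS-symmetric with respect to a faithful state $\sigma_0$, i.e. $\operatorname{Tr}(\sigma_0x^*\mathcal{P}_t(y))=\operatorname{Tr}(\sigma_0\mathcal{P}_t(x)^*y)$ for all $x,y,t$. Let its generator be written as $$\mathcal{L}(x)=\sum_{j\in\mathcal{J}}e^{-\omega_j/2}\big(v_j^*[x,v_j]+[v_j^*,x]v_j\big),$$ where $\mathcal{J}$ is finite, $\omega_j\in\mathbb{R}$, $\sigma_0v_j\sigma_0^{-1}=e^{-\omega_j}v_j$, and the family $(v_j)_{j\in\mathcal{J}}$ of matrices is stable under $v\mapsto v^*$ (counted with multiplicity). Put $\partial_jx=[v_j,x]$ and $|||x|||_{\partial,2}=\big(\sum_{j}\|\partial_jx\|^2\big)^{1/2}$ with the operator norm $\|\cdot\|$, and for states $\varphi,\psi$ put $$W_1(\varphi,\psi)=\sup\{\varphi(x)-\psi(x)\,:\,x=x^*,\ |||x|||_{\partial,2}\le 1\}\in[0,\infty].$$ Let $\mathcal{N}=\{x:\mathcal{P}_t(x)=x\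 \forall t\ge 0\}$. Assume that for some $C,\kappa>0$ $$|||\mathcal{P}_t(x)|||_{\partial,2}\le Ce^{-\kappa t}\,|||x|||_{\partial,2}\qquad\text{for all }t\ge0,\ x\in\mathbb{M}_n(\mathbb{C}).$$ Then there is a unique (completely positive, unital) conditional expectation $E_\mathcal{N}$ of $\mathbb{M}_n(\mathbb{C})$ onto $\mathcal{N}$ preserving $\sigma_0$, and for every density matrix $\rho$ (identified with the state $x\mapsto\operatorname{Tr}(\rho x)$) and every faithful invariant density matrix $\sigma$ of the semigroup, $$W_1(\rho,\rho\circ E_\mathcal{N})\le\frac{C}{\kappa}\,\max_{i\in\mathcal{J}}\big(e^{-\omega_i/4}+e^{\omega_i/4}\big)\sqrt{\mathcal{E}\big(\Gamma_\sigma^{-1/2}(\sqrt\rho)\big)},$$ where $\Gamma_\sigma^{-1/2}(x)=\sigma^{-1/4}x\sigma^{-1/4}$ and $\mathcal{E}(x)=-\operatorname{Tr}\big(x^*\sigma^{1/2}\mathcal{L}(x)\sigma^{1/2}\big)$. (For $\mathcal{J}=\emptyset$ the maximum is read as $0$.) -/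

import Mathlib

open scoped NNReal Topology ComplexOrder Matrix MatrixOrder Matrix.Norms.L2Operator CStarAlgebra

noncomputable section

namespace QuantumTransport

/-- The matrix algebra `𝕄ₙ(ℂ)`; its norm is the operator norm on `ℂⁿ`, its order the Loewner
order. -/
abbrev Mat (n : ℕ) : Type := Matrix (Fin n) (Fin n) ℂ

variable {n : ℕ} {J : Type*}

/-! ### States -/

/-- Density matrices: positive semidefinite of trace one. -/
structure IsDensity (ρ : Mat n) : Prop where
  posSemidef : ρ.PosSemidef
  trace_eq_one : ρ.trace = 1

/-- Densities of faithful states: positive definite of trace one. -/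
structure IsFaithfulDensity (σ : Mat n) : Prop where
  posDef : σ.PosDef
  trace_eq_one : σ.trace = 1

/-- The functional `x ↦ Tr (ρ x)` with density `ρ`. -/
def functional (ρ : Mat n) : Mat n →ₗ[ℂ] ℂ :=
  Matrix.traceLinearMap (Fin n) ℂ ℂ ∘ₗ LinearMap.mulLeft ℂ ρ

/-- The state with density `ρ` is invariant under `Φ`, i.e. `ρ ∘ Φ = ρ` as functionals. -/
def Preserves (Φ : Mat n →CP Mat n) (ρ : Mat n) : Prop :=
  functional ρ ∘ₗ Φ.toLinearMap = functional ρ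

/-! ### Quantum Markov semigroups -/

/-- A quantum Markov semigroup on `𝕄ₙ(ℂ)` in the Heisenberg picture: a continuous one-parameter
semigroup of unital completely positive maps. -/
structure IsQuantumMarkovSemigroup (P : ℝ≥0 → (Mat n →CP Mat n)) : Prop where
  map_one : ∀ t, P t 1 = 1
  zero : ∀ x, P 0 x = x
  add : ∀ s t x, P (s + t) x = P s (P t x)
  continuous : ∀ x, Continuous fun t => P t x

/-- `P` is GNS-symmetric with respect to `σ`:
`σ (x* P_t(y)) = σ (P_t(x)* y)` for all `t, x, y`. -/
def IsGNSSymmetric (P : ℝ≥0 → (Mat n →CP Mat n)) (σ : Mat n) : Prop :=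
  ∀ t x y, functional σ (xᴴ * P t y) = functional σ ((P t x)ᴴ * y)

/-- `L` is the generator of `P`: `L x = lim_{t ↓ 0} (P_t x - x) / t` for all `x`. -/
def IsGenerator (P : ℝ≥0 → (Mat n →CP Mat n)) (L : Mat n → Mat n) : Prop :=
  ∀ x, Filter.Tendsto (fun t : ℝ≥0 => (t : ℝ)⁻¹ • (P t x - x)) (𝓝[>] 0) (𝓝 (L x))

/-- The invariant subalgebra `𝓝 = {x | P_t x = x for all t}`. -/
def invariantSubalgebra (P : ℝ≥0 → (Mat n →CP Mat n)) : Set (Mat n) :=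
  {x | ∀ t, P t x = x}

/-- `E` is a conditional expectation onto `𝓝`: a unital completely positive map into `𝓝` which is
the identity on `𝓝` and satisfies `E (a x b) = a E(x) b` for `a, b ∈ 𝓝`. -/
structure IsConditionalExpectation (N : Set (Mat n)) (E : Mat n →CP Mat n) : Prop where
  map_one : E 1 = 1
  map_mem : ∀ x, E x ∈ N
  map_of_mem : ∀ x ∈ N, E x = x
  map_mul_mul : ∀ a ∈ N, ∀ b ∈ N, ∀ x, E (a * x * b) = a * E x * b

/-! ### Differential structure -/

/-- The partial derivations `∂_j x = [v_j, x]`. -/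
def partialDer (v : J → Mat n) (j : J) (x : Mat n) : Mat n := v j * x - x * v j

/-- The Lipschitz semi-norm `(∑_j ‖∂_j x‖²)^{1/2}` built on the operator norm. -/
def lipNorm [Fintype J] (v : J → Mat n) (x : Mat n) : ℝ :=
  √(∑ j, ‖partialDer v j x‖ ^ 2)

/-- The Lindbladian
`x ↦ ∑_j e^{-ω_j/2} (v_j* [x, v_j] + [v_j*, x] v_j)`. -/
def lindbladian [Fintype J] (v : J → Mat n) (ω : J → ℝ) (x : Mat n) : Mat n :=
  ∑ j, Real.exp (-ω j / 2) •
    ((v j)ᴴ * (x * v j - v j * x) + ((v j)ᴴ * x - x * (v j)ᴴ) * v j)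

/-- `(v, ω)` are Lindblad operators and Bohr frequencies of the semigroup `P` relative to the
faithful state `σ`: the family `v` is stable under adjoints (counted with multiplicity), each `v_j`
satisfies `σ v_j σ⁻¹ = e^{-ω_j} v_j`, and the generator of `P` is the associated Lindbladian. -/
structure IsLindbladForm [Fintype J] (P : ℝ≥0 → (Mat n →CP Mat n)) (σ : Mat n)
    (v : J → Mat n) (ω : J → ℝ) : Prop where
  adjoint_closed : ∃ π : Equiv.Perm J, ∀ j, v (π j) = (v j)ᴴ
  modular : ∀ j, σ * v j * σ⁻¹ = Real.exp (-ω j) • v j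
  generator : IsGenerator P (lindbladian v ω)

/-! ### Transportation cost and Dirichlet form -/

/-- The dual cost `W₁(φ, ψ) = sup {φ(x) - ψ(x) | x = x*, lipNorm x ≤ 1}`, possibly infinite. -/
def wassersteinOne [Fintype J] (v : J → Mat n) (φ ψ : Mat n →ₗ[ℂ] ℂ) : EReal :=
  ⨆ x ∈ {x : Mat n | IsSelfAdjoint x ∧ lipNorm v x ≤ 1}, (((φ x - ψ x).re : ℝ) : EReal)

/-- The `σ`-weighted inner product `⟨x, y⟩_σ = Tr (x* σ^{1/2} y σ^{1/2})`. -/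
def innerσ (σ x y : Mat n) : ℂ :=
  (xᴴ * σ ^ (1 / 2 : ℝ) * y * σ ^ (1 / 2 : ℝ)).trace

/-- The Dirichlet form `𝓔(x) = -⟨x, L x⟩_σ` (a real number for symmetric `L`). -/
def dirichletForm (L : Mat n → Mat n) (σ x : Mat n) : ℝ :=
  (-innerσ σ x (L x)).re

/-- For `Γ_σ(x) = σ^{1/2} x σ^{1/2}`, the power
`Γ_σ^p (x) = σ^{p/2} x σ^{p/2}` (`σ` positive definite). -/
def gammaPow (σ : Mat n) (p : ℝ) (x : Mat n) : Mat n :=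
  σ ^ (p / 2) * x * σ ^ (p / 2)

end QuantumTransport

end

namespace QuantumTransport

/-! ### Trace inequalities and Hilbert–Schmidt estimates -/

section

variable {n : ℕ}

/-! The cost is bounded by integrating `d/dt Tr(ρ P_t x) = Tr(ρ L P_t x)` along the orbit of a test
observable `x`, from `x` at time `0` to `E x` at infinity.

Stability of the family under adjoints puts `L` in divergence form, `L y = ∑ (e^{ω/2} ∂_j y v_j* -
e^{-ω/2} v_j* ∂_j y)`. With `r = √ρ` and `D_j = e^{-ω/4} v_j r - e^{ω/4} r v_j`, the number `Tr(ρ L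
y)` becomes a sum of traces pairing `D_j*`, `r` and `∂_j y`. As `r` has Hilbert–Schmidt norm one,
Cauchy–Schwarz bounds it by `max (e^{-ω/4} + e^{ω/4}) (∑ ‖D_j‖²_HS)^{1/2} lipNorm y`
(`IsModularFamily.norm_trace_mul_lindbladian_le`). The modular relations give `D_j = σ^{1/4}
∂_j(Γ_σ^{-1/2} r) σ^{1/4}`, so `∑ ‖D_j‖²_HS` is exactly the Dirichlet form
(`IsModularFamily.dirichletForm_eq`). Integrating `C e^{-κt}` gives `C/κ`.

The gradient estimate also makes orbits Cauchy and identifies `𝓝` with the commutant of the `v_j`,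
so `E` is the limit of `P_t`. An invariant `σ` may replace `σ₀` because `σ σ₀⁻¹` is a fixed point,
hence commutes with every `v_j`, and `σ` inherits the modular relations. -/

theorem eq_zero_of_trace_mul_eq_zero {σ w : Mat n} (hσ : σ.PosDef)
    (h : (σ * (wᴴ * w)).trace = 0) : w = 0 := by
  have hs : CFC.sqrt σ * CFC.sqrt σ = σ := CFC.sqrt_mul_sqrt_self σ hσ.posSemidef.nonneg
  have hH : (CFC.sqrt σ)ᴴ = CFC.sqrt σ := (Matrix.nonneg_iff_posSemidef.1 (CFC.sqrt_nonneg σ)).isHermitian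
  have h1 : ((w * CFC.sqrt σ)ᴴ * (w * CFC.sqrt σ)).trace = 0 := by
    rw [Matrix.conjTranspose_mul, hH, ← h]
    conv_rhs => rw [← hs, Matrix.mul_assoc, Matrix.trace_mul_comm]
    simp only [Matrix.mul_assoc]
  have h2 := Matrix.trace_conjTranspose_mul_self_eq_zero_iff.1 h1
  have h3 : w * σ = 0 := by rw [← hs, ← Matrix.mul_assoc, h2, Matrix.zero_mul]
  have hu : IsUnit σ := hσ.isUnit
  exact (hu.mul_left_eq_zero).1 h3

theorem trace_mul_conjTranspose_mul_nonneg {a w : Mat n} (ha : a.PosSemidef) :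
    0 ≤ (wᴴ * w * a).trace := by
  rw [Matrix.mul_assoc, Matrix.trace_mul_comm]
  exact (ha.mul_mul_conjTranspose_same w).trace_nonneg

/-- If `a > 0` and `a² v = c² v a²`, then `a v = c v a`. -/
theorem mul_eq_smul_mul_of_sq {a v : Mat n} (ha : a.PosDef) {c : ℝ} (hc : 0 < c)
    (h : a * a * v = (c ^ 2) • (v * (a * a))) : a * v = c • (v * a) := by
  rw [← sub_eq_zero]
  set w := a * v - c • (v * a) with hw
  have h0 : a * w + c • (w * a) = 0 := by
    have : a * w + c • (w * a) = a * a * v - c ^ 2 • (v * (a * a)) := by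
      rw [hw]
      simp only [mul_sub, sub_mul, smul_sub, mul_smul_comm, smul_mul_assoc, smul_smul,
        Matrix.mul_assoc, pow_two]
      abel
    rw [this, h, sub_self]
  -- Pairing with `wᴴ` under the trace yields two nonnegative numbers with zero sum, so both vanish.
  have h1 : (wᴴ * a * w).trace + (c : ℂ) * (wᴴ * w * a).trace = 0 := by
    have := congrArg (fun z => (wᴴ * z).trace) h0
    simpa [mul_add, Matrix.mul_assoc, Matrix.trace_smul, Matrix.trace_add] using this
  have p1 : 0 ≤ (wᴴ * a * w).trace := (ha.posSemidef.conjTranspose_mul_mul_same w).trace_nonneg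
  have p2 := trace_mul_conjTranspose_mul_nonneg (w := w) ha.posSemidef
  have hc' : (0 : ℂ) < c := by exact_mod_cast hc
  have h2 : (c : ℂ) * (wᴴ * w * a).trace = 0 :=
    ((add_eq_zero_iff_of_nonneg p1 (mul_nonneg hc'.le p2)).1 h1).2
  have h3 := (mul_eq_zero.1 h2).resolve_left hc'.ne'
  rw [Matrix.trace_mul_comm] at h3
  exact eq_zero_of_trace_mul_eq_zero ha h3

/-- The square of the Hilbert–Schmidt norm. -/
noncomputable def hsSq (A : Mat n) : ℝ := (Aᴴ * A).trace.re

theorem hsSq_eq_sum (A : Mat n) : hsSq A = ∑ i, ∑ j, ‖A i j‖ ^ 2 := by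
  rw [hsSq, Finset.sum_comm]
  simp only [Matrix.trace, Matrix.diag, Matrix.mul_apply, Matrix.conjTranspose_apply,
    Complex.re_sum]
  refine Finset.sum_congr rfl fun i _ => Finset.sum_congr rfl fun j _ => ?_
  rw [← Complex.normSq_eq_norm_sq, Complex.normSq_apply]
  simp

theorem hsSq_nonneg (A : Mat n) : 0 ≤ hsSq A := by
  rw [hsSq_eq_sum]; positivity

theorem hsSq_conjTranspose (A : Mat n) : hsSq Aᴴ = hsSq A := by
  rw [hsSq, hsSq, Matrix.conjTranspose_conjTranspose, Matrix.trace_mul_comm]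

theorem norm_trace_mul_le (A B : Mat n) : ‖(A * B).trace‖ ≤ √(hsSq A) * √(hsSq B) := by
  have hcs := Real.sum_mul_le_sqrt_mul_sqrt Finset.univ
    (fun p : Fin n × Fin n => ‖A p.1 p.2‖) (fun p => ‖Bᴴ p.1 p.2‖)
  simp only [Fintype.sum_prod_type] at hcs
  rw [← hsSq_conjTranspose B, hsSq_eq_sum, hsSq_eq_sum]
  refine le_trans ?_ hcs
  simp only [Matrix.trace, Matrix.diag, Matrix.mul_apply]
  refine (norm_sum_le _ _).trans (Finset.sum_le_sum fun i _ => ?_)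
  refine (norm_sum_le _ _).trans (Finset.sum_le_sum fun j _ => ?_)
  rw [norm_mul, Matrix.conjTranspose_apply, norm_star]

/-- Conjugate the operator inequality `Y*Y ≤ ‖Y‖²` by `r` and take the trace. -/
theorem hsSq_mul_le (Y r : Mat n) : hsSq (Y * r) ≤ ‖Y‖ ^ 2 * hsSq r := by
  have h1 : star Y * Y ≤ algebraMap ℝ (Mat n) (‖Y‖ ^ 2) :=
    CStarAlgebra.star_mul_le_algebraMap_norm_sq
  have h2 := (Matrix.le_iff.1 h1).conjTranspose_mul_mul_same r
  have h3 := (Complex.le_def.1 h2.trace_nonneg).1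
  have h4 : rᴴ * (algebraMap ℝ (Mat n) (‖Y‖ ^ 2) - star Y * Y) * r =
      (‖Y‖ ^ 2) • (rᴴ * r) - (Y * r)ᴴ * (Y * r) := by
    rw [Algebra.algebraMap_eq_smul_one, Matrix.conjTranspose_mul, Matrix.star_eq_conjTranspose]
    simp only [mul_sub, sub_mul, mul_smul_comm, smul_mul_assoc, mul_one, Matrix.mul_assoc]
  rw [h4, Matrix.trace_sub, Matrix.trace_smul] at h3
  simp only [Complex.zero_re, Complex.sub_re, Complex.real_smul, Complex.re_ofReal_mul] at h3
  exact sub_nonneg.1 h3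

theorem norm_trace_mul_mul_le (D Y r : Mat n) (hr : hsSq r = 1) :
    ‖(r * D * Y).trace‖ ≤ √(hsSq D) * ‖Y‖ := by
  rw [Matrix.mul_assoc, Matrix.trace_mul_comm, Matrix.mul_assoc]
  refine (norm_trace_mul_le _ _).trans ?_
  gcongr
  refine Real.sqrt_le_iff.2 ⟨norm_nonneg _, ?_⟩
  simpa [hr] using hsSq_mul_le Y r

theorem norm_trace_mul_mul_le' (D Y r : Mat n) (hr : hsSq r = 1) :
    ‖(D * r * Y).trace‖ ≤ √(hsSq D) * ‖Y‖ := by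
  have := norm_trace_mul_mul_le Dᴴ Yᴴ rᴴ (by rw [hsSq_conjTranspose, hr])
  rw [hsSq_conjTranspose, Matrix.l2_opNorm_conjTranspose, ← norm_star] at this
  rw [Matrix.mul_assoc]
  rwa [← Matrix.trace_conjTranspose, Matrix.conjTranspose_mul, Matrix.conjTranspose_mul,
    Matrix.conjTranspose_conjTranspose, Matrix.conjTranspose_conjTranspose,
    Matrix.conjTranspose_conjTranspose, ← Matrix.mul_assoc, Matrix.mul_assoc,
    Matrix.trace_mul_comm, Matrix.mul_assoc] at this

end

/-! ### Modular relations, the Dirichlet form and the key trace bound -/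

section

variable {n : ℕ} {J : Type*}

theorem mul_eq_of_modular {σ v : Mat n} (hσ : σ.PosDef) {c : ℝ}
    (h : σ * v * σ⁻¹ = c • v) : σ * v = c • (v * σ) := by
  have h1 := congrArg (· * σ) h
  simpa [Matrix.mul_assoc, Matrix.nonsing_inv_mul _ ((Matrix.isUnit_iff_isUnit_det _).1 hσ.isUnit)]
    using h1

theorem posDef_rpow {σ : Mat n} (hσ : σ.PosDef) (s : ℝ) : (σ ^ s).PosDef := by
  refine (Matrix.nonneg_iff_posSemidef.1 CFC.rpow_nonneg).posDef_iff_isUnit.2 ?_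
  exact IsUnit.cfcRpow hσ.isUnit s hσ.posSemidef.nonneg

/-- Halving the exponent halves the modular frequency, by uniqueness of positive square roots; two
applications reach `σ^{1/4}`. -/
theorem rpow_half_mul_eq {σ v : Mat n} (hσ : σ.PosDef) {a s : ℝ}
    (h : σ ^ s * v = Real.exp a • (v * σ ^ s)) :
    σ ^ (s / 2) * v = Real.exp (a / 2) • (v * σ ^ (s / 2)) := by
  refine mul_eq_smul_mul_of_sq (posDef_rpow hσ _) (Real.exp_pos _) ?_
  rw [← CFC.rpow_add hσ.isUnit, add_halves, h, ← Real.exp_nat_mul]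
  congr 2; push_cast; ring

/-- Lindblad operators stable under adjoints, with modular relations for the faithful `σ`. -/
structure IsModularFamily (σ : Mat n) (v : J → Mat n) (ω : J → ℝ) : Prop where
  adjoint_closed : ∃ π : Equiv.Perm J, ∀ j, v (π j) = (v j)ᴴ
  mul_eq : ∀ j, σ * v j = Real.exp (-ω j) • (v j * σ)

theorem mul_conjTranspose_eq {σ v : Mat n} (hσ : σ.PosDef) {a : ℝ}
    (h : σ * v = Real.exp (-a) • (v * σ)) : σ * vᴴ = Real.exp a • (vᴴ * σ) := by
  have h1 := congrArg Matrix.conjTranspose h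
  rw [Matrix.conjTranspose_mul, Matrix.conjTranspose_smul, Matrix.conjTranspose_mul,
    hσ.isHermitian.eq] at h1
  rw [h1, star_trivial, smul_smul, ← Real.exp_add]
  simp

/-- The relation at `π j` and the adjoint of the relation at `j` concern the same matrix, so their
factors agree unless it is zero, in which case the frequencies are unconstrained. -/
theorem IsModularFamily.smul_conjTranspose {σ : Mat n} {v : J → Mat n} {ω : J → ℝ}
    (hσ : σ.PosDef) (h : IsModularFamily σ v ω) {π : Equiv.Perm J}
    (hπ : ∀ j, v (π j) = (v j)ᴴ) (j : J) : v j = 0 ∨ ω (π j) = - ω j := by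
  by_cases hv : v j = 0
  · exact .inl hv
  right
  have h1 := mul_conjTranspose_eq hσ (h.mul_eq j)
  have h2 := h.mul_eq (π j)
  rw [hπ, h1, ← sub_eq_zero, ← sub_smul, smul_eq_zero] at h2
  rcases h2 with h2 | h2
  · have := Real.exp_injective (sub_eq_zero.1 h2); linarith
  · rw [hσ.isUnit.mul_left_eq_zero, Matrix.conjTranspose_eq_zero] at h2
    exact absurd h2 hv

section
variable [Fintype J]

theorem sum_mul_norm_le_mul_lipNorm (v : J → Mat n) (d : J → ℝ) (x : Mat n) :
    ∑ j, d j * ‖partialDer v j x‖ ≤ √(∑ j, d j ^ 2) * lipNorm v x :=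
  Real.sum_mul_le_sqrt_mul_sqrt _ _ _

theorem lipNorm_nonneg (v : J → Mat n) (x : Mat n) : 0 ≤ lipNorm v x := Real.sqrt_nonneg _

theorem lipNorm_eq_zero_iff (v : J → Mat n) (x : Mat n) :
    lipNorm v x = 0 ↔ ∀ j, partialDer v j x = 0 := by
  rw [lipNorm, Real.sqrt_eq_zero (by positivity),
    Finset.sum_eq_zero_iff_of_nonneg (fun _ _ => by positivity)]
  simp

/-- Reindexing one half of the sum by the adjoint permutation exchanges `v_j` with `v_j*` and flips
the sign of `ω_j`. -/
theorem IsModularFamily.lindbladian_eq {σ : Mat n} {v : J → Mat n} {ω : J → ℝ}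
    (hσ : σ.PosDef) (h : IsModularFamily σ v ω) (x : Mat n) :
    lindbladian v ω x = ∑ j, (Real.exp (ω j / 2) • (partialDer v j x * (v j)ᴴ)
      - Real.exp (-ω j / 2) • ((v j)ᴴ * partialDer v j x)) := by
  obtain ⟨π, hπ⟩ := h.adjoint_closed
  simp only [lindbladian, smul_add, Finset.sum_add_distrib, Finset.sum_sub_distrib]
  rw [add_comm, sub_eq_add_neg, ← Finset.sum_neg_distrib]
  congr 1
  · rw [← Equiv.sum_comp π (fun j => Real.exp (ω j / 2) • (partialDer v j x * (v j)ᴴ))]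
    refine Finset.sum_congr rfl fun j _ => ?_
    simp only [partialDer, hπ, Matrix.conjTranspose_conjTranspose]
    rcases h.smul_conjTranspose hσ hπ j with h0 | h0
    · simp [h0]
    · rw [h0]
  · refine Finset.sum_congr rfl fun j _ => ?_
    rw [← smul_neg, partialDer, ← mul_neg, neg_sub]

/-- Integration by parts: commuting `v_j*` past `σ^{1/2}` absorbs the weights `e^{±ω/2}` and leaves
`Tr(d* σ^{1/2} d σ^{1/2})` with `d = ∂_j z`. Commuting `v_j` past `σ^{1/4}` turns `σ^{1/4} d
σ^{1/4}` into the twisted commutator of `v_j` and `r`. -/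
theorem IsModularFamily.dirichletForm_eq {σ : Mat n} {v : J → Mat n} {ω : J → ℝ}
    (hσ : σ.PosDef) (h : IsModularFamily σ v ω) (r : Mat n) :
    dirichletForm (lindbladian v ω) σ (gammaPow σ (-1 / 2) r) =
      ∑ j, hsSq (Real.exp (-ω j / 4) • (v j * r) - Real.exp (ω j / 4) • (r * v j)) := by
  set q := σ ^ (1 / 4 : ℝ) with hq
  set z := gammaPow σ (-1 / 2) r with hz
  have hqq : σ ^ (1 / 2 : ℝ) = q * q := by
    rw [hq, ← CFC.rpow_add hσ.isUnit]; norm_num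
  have hqH : qᴴ = q := (posDef_rpow hσ _).isHermitian
  have hqi : q * σ ^ (-1 / 4 : ℝ) = 1 := by
    rw [hq, ← CFC.rpow_add hσ.isUnit]; norm_num; exact CFC.rpow_zero σ hσ.posSemidef.nonneg
  have hiq : σ ^ (-1 / 4 : ℝ) * q = 1 := by
    rw [hq, ← CFC.rpow_add hσ.isUnit]; norm_num; exact CFC.rpow_zero σ hσ.posSemidef.nonneg
  have hqz : q * z * q = r := by
    rw [hz, gammaPow, show (-1 / 2 / 2 : ℝ) = -1 / 4 by norm_num]
    calc _ = (q * σ ^ (-1 / 4 : ℝ)) * r * (σ ^ (-1 / 4 : ℝ) * q) := by noncomm_ring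
      _ = r := by rw [hqi, hiq]; simp
  have hh : ∀ j, σ ^ (1 / 2 : ℝ) * v j = Real.exp (-ω j / 2) • (v j * σ ^ (1 / 2 : ℝ)) := fun j =>
    rpow_half_mul_eq hσ (by rw [CFC.rpow_one σ hσ.posSemidef.nonneg]; exact h.mul_eq j)
  have hv : ∀ j, q * v j = Real.exp (-ω j / 4) • (v j * q) := fun j => by
    have := rpow_half_mul_eq hσ (hh j)
    rwa [show (1 / 2 / 2 : ℝ) = 1 / 4 by norm_num, show -ω j / 2 / 2 = -ω j / 4 by ring] at this
  have hv' : ∀ j, v j * q = Real.exp (ω j / 4) • (q * v j) := fun j => by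
    rw [hv, smul_smul, ← Real.exp_add]; simp [neg_div]
  have hhH : ∀ j, (v j)ᴴ * σ ^ (1 / 2 : ℝ) = Real.exp (-ω j / 2) • (σ ^ (1 / 2 : ℝ) * (v j)ᴴ) := by
    intro j
    have h1 := congrArg Matrix.conjTranspose (hh j)
    rwa [Matrix.conjTranspose_mul, Matrix.conjTranspose_smul, Matrix.conjTranspose_mul,
      (posDef_rpow hσ _).isHermitian.eq, star_trivial] at h1
  have hD : ∀ j, Real.exp (-ω j / 4) • (v j * r) - Real.exp (ω j / 4) • (r * v j) =
      q * partialDer v j z * q := by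
    intro j
    have e1 : q * (v j * z) * q = Real.exp (-ω j / 4) • (v j * r) := by
      rw [← mul_assoc, hv, smul_mul_assoc, smul_mul_assoc, ← hqz]; simp only [mul_assoc]
    have e2 : q * (z * v j) * q = Real.exp (ω j / 4) • (r * v j) := by
      rw [mul_assoc, mul_assoc, hv', mul_smul_comm, mul_smul_comm, ← hqz]; simp only [mul_assoc]
    rw [← e1, ← e2, partialDer, mul_sub, sub_mul]
  rw [dirichletForm, innerσ, h.lindbladian_eq hσ, Finset.mul_sum, Finset.sum_mul,
    Matrix.trace_sum, ← Finset.sum_neg_distrib, Complex.re_sum]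
  refine Finset.sum_congr rfl fun j _ => ?_
  rw [hD, hsSq]
  congr 1
  set d := partialDer v j z with hd
  set s := σ ^ (1 / 2 : ℝ) with hs
  have t1 : (zᴴ * s * (Real.exp (ω j / 2) • (d * (v j)ᴴ)) * s).trace =
      ((v j)ᴴ * zᴴ * s * d * s).trace := by
    have : zᴴ * s * (Real.exp (ω j / 2) • (d * (v j)ᴴ)) * s = (zᴴ * s * d * s) * (v j)ᴴ := by
      simp only [mul_smul_comm, smul_mul_assoc, mul_assoc]
      rw [hhH j]
      simp only [mul_smul_comm, smul_smul, ← Real.exp_add]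
      simp [neg_div]
    rw [this, Matrix.trace_mul_comm]
    simp only [mul_assoc]
  have t2 : zᴴ * s * (Real.exp (-ω j / 2) • ((v j)ᴴ * d)) * s = zᴴ * (v j)ᴴ * s * d * s := by
    have := hhH j
    calc _ = zᴴ * (Real.exp (-ω j / 2) • (s * (v j)ᴴ)) * d * s := by
          simp only [mul_smul_comm, smul_mul_assoc, mul_assoc]
      _ = _ := by rw [← this]; simp only [mul_assoc]
  rw [mul_sub, sub_mul, Matrix.trace_sub, t1, t2, neg_sub, ← Matrix.trace_sub,
    Matrix.conjTranspose_mul, Matrix.conjTranspose_mul, hqH]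
  have hdH : zᴴ * (v j)ᴴ * s * d * s - (v j)ᴴ * zᴴ * s * d * s = dᴴ * s * d * s := by
    rw [hd, partialDer, Matrix.conjTranspose_sub, Matrix.conjTranspose_mul,
      Matrix.conjTranspose_mul]
    simp only [sub_mul]
  rw [hdH, hqq]
  rw [show dᴴ * (q * q) * d * (q * q) = (dᴴ * (q * q) * d * q) * q by simp only [mul_assoc],
    Matrix.trace_mul_comm]
  simp only [mul_assoc]

theorem hsSq_sqrt {ρ : Mat n} (hρ : IsDensity ρ) : hsSq (CFC.sqrt ρ) = 1 := by
  have hH : (CFC.sqrt ρ)ᴴ = CFC.sqrt ρ :=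
    (Matrix.nonneg_iff_posSemidef.1 (CFC.sqrt_nonneg ρ)).isHermitian
  rw [hsSq, hH, CFC.sqrt_mul_sqrt_self ρ hρ.posSemidef.nonneg, hρ.trace_eq_one, Complex.one_re]

theorem IsModularFamily.norm_trace_mul_lindbladian_le {σ : Mat n} {v : J → Mat n} {ω : J → ℝ}
    (hσ : σ.PosDef) (h : IsModularFamily σ v ω) {ρ : Mat n} (hρ : IsDensity ρ) (y : Mat n) :
    ‖(ρ * lindbladian v ω y).trace‖ ≤ (⨆ i, (Real.exp (-ω i / 4) + Real.exp (ω i / 4))) *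
      √(dirichletForm (lindbladian v ω) σ (gammaPow σ (-1 / 2) (CFC.sqrt ρ))) * lipNorm v y := by
  set r := CFC.sqrt ρ with hr
  set M := ⨆ i, (Real.exp (-ω i / 4) + Real.exp (ω i / 4)) with hM
  have hr1 : hsSq r = 1 := hsSq_sqrt hρ
  have hrH : rᴴ = r := (Matrix.nonneg_iff_posSemidef.1 (CFC.sqrt_nonneg ρ)).isHermitian
  have hrr : ρ = r * r := (CFC.sqrt_mul_sqrt_self ρ hρ.posSemidef.nonneg).symm
  have hM' : ∀ j, Real.exp (-ω j / 4) + Real.exp (ω j / 4) ≤ M :=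
    fun j => le_ciSup (f := fun i => Real.exp (-ω i / 4) + Real.exp (ω i / 4))
      (Set.finite_range _).bddAbove j
  -- This covers empty `J` too, where the real supremum is `0`.
  have hM0 : 0 ≤ M := Real.iSup_nonneg fun i => by positivity
  set D : J → Mat n := fun j => Real.exp (-ω j / 4) • (v j * r) - Real.exp (ω j / 4) • (r * v j)
    with hD
  have hDH : ∀ j, (D j)ᴴ = Real.exp (-ω j / 4) • (r * (v j)ᴴ) - Real.exp (ω j / 4) • ((v j)ᴴ * r) :=
    fun j => by simp [hD, Matrix.conjTranspose_smul, Matrix.conjTranspose_mul, hrH]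
  -- Splitting `e^{±ω/2}` into two factors `e^{±ω/4}`, the two terms on the right each contain `r
  -- v_j* r` with opposite signs; these cancel.
  have key : ∀ j, (ρ * (Real.exp (ω j / 2) • (partialDer v j y * (v j)ᴴ)
      - Real.exp (-ω j / 2) • ((v j)ᴴ * partialDer v j y))).trace =
      - (Real.exp (ω j / 4) • ((D j)ᴴ * r * partialDer v j y).trace
        + Real.exp (-ω j / 4) • (r * (D j)ᴴ * partialDer v j y).trace) := by
    intro j
    set d := partialDer v j y
    have e1 : Real.exp (ω j / 4) * Real.exp (ω j / 4) = Real.exp (ω j / 2) := by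
      rw [← Real.exp_add]; ring_nf
    have e2 : Real.exp (-ω j / 4) * Real.exp (-ω j / 4) = Real.exp (-ω j / 2) := by
      rw [← Real.exp_add]; ring_nf
    have e3 : Real.exp (-ω j / 4) * Real.exp (ω j / 4) = 1 := by
      rw [← Real.exp_add]; ring_nf; simp
    have e4 : Real.exp (ω j / 4) * Real.exp (-ω j / 4) = 1 := by rw [mul_comm, e3]
    rw [mul_sub, Matrix.trace_sub, mul_smul_comm, Matrix.trace_smul, ← mul_assoc,
      Matrix.trace_mul_comm, mul_smul_comm, Matrix.trace_smul, ← Matrix.trace_smul,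
      ← Matrix.trace_smul, ← Matrix.trace_smul, ← Matrix.trace_smul, ← Matrix.trace_sub,
      ← Matrix.trace_add, ← Matrix.trace_neg, hDH, hrr]
    congr 1
    simp only [mul_sub, sub_mul, mul_smul_comm, smul_mul_assoc, mul_assoc, smul_sub, smul_smul,
      e1, e2, e3, e4, one_smul]
    abel
  rw [h.dirichletForm_eq hσ, h.lindbladian_eq hσ, Finset.mul_sum, Matrix.trace_sum]
  calc _ ≤ ∑ j, ‖(ρ * (Real.exp (ω j / 2) • (partialDer v j y * (v j)ᴴ)
      - Real.exp (-ω j / 2) • ((v j)ᴴ * partialDer v j y))).trace‖ := norm_sum_le _ _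
    _ ≤ ∑ j, M * (√(hsSq (D j)) * ‖partialDer v j y‖) := by
      refine Finset.sum_le_sum fun j _ => ?_
      rw [key, norm_neg]
      have b1 := norm_trace_mul_mul_le' (D j)ᴴ (partialDer v j y) r hr1
      have b2 := norm_trace_mul_mul_le (D j)ᴴ (partialDer v j y) r hr1
      rw [hsSq_conjTranspose] at b1 b2
      refine (norm_add_le _ _).trans ?_
      rw [norm_smul, norm_smul, Real.norm_of_nonneg (Real.exp_pos _).le,
        Real.norm_of_nonneg (Real.exp_pos _).le]
      calc _ ≤ Real.exp (ω j / 4) * (√(hsSq (D j)) * ‖partialDer v j y‖) +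
            Real.exp (-ω j / 4) * (√(hsSq (D j)) * ‖partialDer v j y‖) := by gcongr
        _ = (Real.exp (-ω j / 4) + Real.exp (ω j / 4)) *
            (√(hsSq (D j)) * ‖partialDer v j y‖) := by ring
        _ ≤ _ := by gcongr; exact hM' j
    _ = M * ∑ j, √(hsSq (D j)) * ‖partialDer v j y‖ := by rw [Finset.mul_sum]
    _ ≤ M * (√(∑ j, √(hsSq (D j)) ^ 2) * lipNorm v y) := by
      gcongr; exact sum_mul_norm_le_mul_lipNorm _ _ _
    _ = _ := by simp only [Real.sq_sqrt (hsSq_nonneg _), mul_assoc, hD]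

/-- A crude bound whose constant does not enter the final estimate; it only serves to show that
orbits converge. -/
theorem IsModularFamily.norm_lindbladian_le {σ : Mat n} {v : J → Mat n} {ω : J → ℝ}
    (hσ : σ.PosDef) (h : IsModularFamily σ v ω) :
    ∃ K : ℝ, 0 ≤ K ∧ ∀ y, ‖lindbladian v ω y‖ ≤ K * lipNorm v y := by
  set d : J → ℝ := fun j => Real.exp (ω j / 2) * ‖(v j)ᴴ‖ + Real.exp (-ω j / 2) * ‖(v j)ᴴ‖
  refine ⟨√(∑ j, d j ^ 2), Real.sqrt_nonneg _, fun y => ?_⟩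
  refine le_trans ?_ (sum_mul_norm_le_mul_lipNorm v d y)
  rw [h.lindbladian_eq hσ]
  refine (norm_sum_le _ _).trans (Finset.sum_le_sum fun j _ => ?_)
  refine (norm_sub_le _ _).trans ?_
  rw [norm_smul, norm_smul, Real.norm_of_nonneg (Real.exp_pos _).le,
    Real.norm_of_nonneg (Real.exp_pos _).le, add_mul, mul_assoc, mul_assoc]
  gcongr
  · rw [mul_comm ‖(v j)ᴴ‖]; exact norm_mul_le _ _
  · exact norm_mul_le _ _

end

end

/-! ### Exponential decay, limits of orbits and intertwining -/

section

open Filter Set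

section Decay

variable {F : Type*} [NormedAddCommGroup F] [NormedSpace ℝ F]

/-- A curve whose velocity decays exponentially moves by at most the integral of the bound. -/
theorem norm_sub_le_of_norm_deriv_right_le_exp {f f' : ℝ → F} {A κ : ℝ} (hκ : 0 < κ)
    (hf : ContinuousOn f (Ici 0)) (hf' : ∀ t, 0 ≤ t → HasDerivWithinAt f (f' t) (Ici t) t)
    (hb : ∀ t, 0 ≤ t → ‖f' t‖ ≤ A * Real.exp (-κ * t)) {a b : ℝ} (ha : 0 ≤ a) (hab : a ≤ b) :
    ‖f b - f a‖ ≤ A / κ * (Real.exp (-κ * a) - Real.exp (-κ * b)) := by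
  have hB : ∀ x, HasDerivAt (fun s => A / κ * (Real.exp (-κ * a) - Real.exp (-κ * s)))
      (A * Real.exp (-κ * x)) x := by
    intro x
    have h1 : HasDerivAt (fun s : ℝ => -κ * s) (-κ) x := by
      simpa using (hasDerivAt_id x).const_mul (-κ)
    have h2 := (h1.exp.const_sub (Real.exp (-κ * a))).const_mul (A / κ)
    have e : A / κ * -(Real.exp (-κ * x) * -κ) = A * Real.exp (-κ * x) := by
      field_simp
    rwa [e] at h2
  refine image_norm_le_of_norm_deriv_right_le_deriv_boundary (f := fun s => f s - f a) (f' := f')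
    (a := a) (b := b) ?_ ?_ (by simp) hB ?_ ⟨hab, le_rfl⟩
  · exact (hf.mono fun x hx => ha.trans hx.1).sub continuousOn_const
  · intro x hx
    exact (hf' x (ha.trans hx.1)).sub_const _
  · intro x hx
    exact hb x (ha.trans hx.1)

theorem exists_tendsto_of_norm_deriv_right_le_exp [CompleteSpace F] {f f' : ℝ → F} {A κ : ℝ}
    (hκ : 0 < κ) (hA : 0 ≤ A)
    (hf : ContinuousOn f (Ici 0)) (hf' : ∀ t, 0 ≤ t → HasDerivWithinAt f (f' t) (Ici t) t)
    (hb : ∀ t, 0 ≤ t → ‖f' t‖ ≤ A * Real.exp (-κ * t)) :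
    ∃ y, Tendsto f atTop (𝓝 y) := by
  refine cauchy_map_iff_exists_tendsto.1 ?_
  rw [Metric.cauchy_iff]
  refine ⟨inferInstance, fun ε hε => ?_⟩
  -- The factor 2 pays for comparing two late times through the common time `T`.
  have hlim : Tendsto (fun t : ℝ => 2 * (A / κ * Real.exp (-κ * t))) atTop (𝓝 0) := by
    have h1 : Tendsto (fun t : ℝ => -κ * t) atTop atBot :=
      tendsto_id.const_mul_atTop_of_neg (neg_lt_zero.2 hκ)
    simpa using ((Real.tendsto_exp_atBot.comp h1).const_mul (A / κ)).const_mul 2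
  obtain ⟨T, hT, hT0⟩ := ((hlim.eventually_lt_const hε).and (eventually_ge_atTop 0)).exists
  have key : ∀ t, T ≤ t → dist (f t) (f T) ≤ A / κ * Real.exp (-κ * T) := by
    intro t ht
    rw [dist_eq_norm]
    refine (norm_sub_le_of_norm_deriv_right_le_exp hκ hf hf' hb hT0 ht).trans ?_
    gcongr
    linarith [Real.exp_pos (-κ * t)]
  refine ⟨f '' Ici T, image_mem_map (Ici_mem_atTop T), ?_⟩
  rintro _ ⟨s, hs, rfl⟩ _ ⟨t, ht, rfl⟩
  have := dist_triangle_right (f s) (f t) (f T)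
  linarith [key s hs, key t ht]

end Decay

variable {n : ℕ} {J : Type*}

theorem conjTranspose_mul_comm_of_partialDer_eq_zero {v : J → Mat n}
    (hv : ∃ π : Equiv.Perm J, ∀ j, v (π j) = (v j)ᴴ) {x : Mat n}
    (hx : ∀ j, partialDer v j x = 0) (j : J) : (v j)ᴴ * x = x * (v j)ᴴ := by
  obtain ⟨π, hπ⟩ := hv
  have := hx (π j)
  rwa [partialDer, sub_eq_zero, hπ] at this

theorem partialDer_conjTranspose_eq_zero {v : J → Mat n}
    (hv : ∃ π : Equiv.Perm J, ∀ j, v (π j) = (v j)ᴴ) {x : Mat n}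
    (hx : ∀ j, partialDer v j x = 0) (j : J) : partialDer v j xᴴ = 0 := by
  have := congrArg Matrix.conjTranspose (conjTranspose_mul_comm_of_partialDer_eq_zero hv hx j)
  simp only [Matrix.conjTranspose_mul, Matrix.conjTranspose_conjTranspose] at this
  rw [partialDer, this, sub_self]

variable [Fintype J]

/-- The limit of completely positive maps is completely positive. -/
theorem exists_completelyPositiveMap_of_tendsto {Φ : ℕ → (Mat n →CP Mat n)}
    (h : ∀ x, ∃ y, Tendsto (fun k => Φ k x) atTop (𝓝 y)) :
    ∃ E : Mat n →CP Mat n, ∀ x, Tendsto (fun k => Φ k x) atTop (𝓝 (E x)) := by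
  choose e he using h
  let e' : Mat n →ₗ[ℂ] Mat n :=
    { toFun := e
      map_add' := fun x y => tendsto_nhds_unique (he (x + y)) (by
        simpa only [map_add] using (he x).add (he y))
      map_smul' := fun c x => tendsto_nhds_unique (he (c • x)) (by
        simpa only [map_smul, RingHom.id_apply] using (he x).const_smul c) }
  refine ⟨⟨e', fun k M hM => ?_⟩, he⟩
  have hlim : Tendsto (fun m => M.map (Φ m)) atTop (𝓝 (M.map e')) := by
    have h1 : Tendsto (fun m => (Matrix.of fun i j => Φ m (M i j))) atTop
        (𝓝 (Matrix.of fun i j => e (M i j))) :=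
      tendsto_pi_nhds.2 fun i => tendsto_pi_nhds.2 fun j => he (M i j)
    exact (CStarMatrix.ofMatrixL.continuous.tendsto _).comp h1
  exact ge_of_tendsto' hlim fun m => (Φ m).map_cstarMatrix_nonneg' k M hM

theorem lindbladian_mul_mul {v : J → Mat n} (ω : J → ℝ) {a b : Mat n}
    (ha : ∀ j, partialDer v j a = 0) (hb : ∀ j, partialDer v j b = 0)
    (ha' : ∀ j, (v j)ᴴ * a = a * (v j)ᴴ) (hb' : ∀ j, (v j)ᴴ * b = b * (v j)ᴴ) (x : Mat n) :
    lindbladian v ω (a * x * b) = a * lindbladian v ω x * b := by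
  simp only [partialDer, sub_eq_zero] at ha hb
  simp only [lindbladian, Finset.mul_sum, Finset.sum_mul]
  refine Finset.sum_congr rfl fun j _ => ?_
  rw [mul_smul_comm, smul_mul_assoc]
  congr 1
  have haj := ha j
  have hbj := hb j
  have haj' := ha' j
  have hbj' := hb' j
  generalize (v j)ᴴ = w at haj' hbj' ⊢
  have e1 : w * (a * x * b * v j) = a * (w * (x * v j)) * b := by
    rw [mul_assoc (a * x), ← hbj, ← mul_assoc w, ← mul_assoc w, haj']; simp only [mul_assoc]
  have e2 : w * (v j * (a * x * b)) = a * (w * (v j * x)) * b := by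
    rw [← mul_assoc (v j), ← mul_assoc (v j), haj, ← mul_assoc w, mul_assoc a, ← mul_assoc w,
      haj']; simp only [mul_assoc]
  have e3 : w * (a * x * b) * v j = a * (w * x * v j) * b := by
    rw [← mul_assoc w, ← mul_assoc w, haj', mul_assoc _ b, ← hbj]; simp only [mul_assoc]
  have e4 : a * x * b * w * v j = a * (x * w * v j) * b := by
    rw [mul_assoc _ b, ← hbj', mul_assoc _ _ (v j), mul_assoc _ b, ← hbj]
    simp only [mul_assoc]
  simp only [mul_sub, sub_mul, mul_add, add_mul]
  rw [e1, e2, e3, e4]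

/-- The Lindbladian as a continuous linear map. -/
theorem exists_continuousLinearMap_lindbladian (v : J → Mat n) (ω : J → ℝ) :
    ∃ T : Mat n →L[ℝ] Mat n, ∀ x, T x = lindbladian v ω x := by
  let T : Mat n →ₗ[ℝ] Mat n :=
    { toFun := lindbladian v ω
      map_add' := fun x y => by
        simp only [lindbladian, ← Finset.sum_add_distrib]
        refine Finset.sum_congr rfl fun j _ => ?_
        rw [← smul_add]
        congr 1
        noncomm_ring
      map_smul' := fun c x => by
        simp only [lindbladian, Finset.smul_sum, RingHom.id_apply]
        refine Finset.sum_congr rfl fun j _ => ?_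
        rw [smul_comm c]
        congr 1
        simp only [smul_mul_assoc, mul_smul_comm, ← smul_sub, ← smul_add] }
  exact ⟨LinearMap.toContinuousLinearMap T, fun x => rfl⟩

section Semigroup

variable {P : ℝ≥0 → (Mat n →CP Mat n)} {L : Mat n → Mat n}

theorem continuous_orbit (hP : IsQuantumMarkovSemigroup P) (x : Mat n) :
    Continuous fun t : ℝ => P t.toNNReal x :=
  (hP.continuous x).comp continuous_real_toNNReal

/-- The semigroup law turns the right difference quotient at `t` into the one at `0` for the point
`P_t x`. -/
theorem hasDerivWithinAt_orbit (hP : IsQuantumMarkovSemigroup P) (hL : IsGenerator P L)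
    (x : Mat n) (t : ℝ) (ht : 0 ≤ t) :
    HasDerivWithinAt (fun s : ℝ => P s.toNNReal x) (L (P t.toNNReal x)) (Ici t) t := by
  rw [hasDerivWithinAt_iff_tendsto_slope, Ici_sdiff_left]
  have hmap : Tendsto (fun s : ℝ => (s - t).toNNReal) (𝓝[>] t) (𝓝[>] 0) := by
    refine tendsto_nhdsWithin_iff.2 ⟨?_, ?_⟩
    · have : Continuous fun s : ℝ => (s - t).toNNReal := by fun_prop
      simpa using (this.tendsto t).mono_left nhdsWithin_le_nhds
    · filter_upwards [self_mem_nhdsWithin] with s hs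
      exact Real.toNNReal_pos.2 (sub_pos.2 hs)
  refine ((hL (P t.toNNReal x)).comp hmap).congr' ?_
  filter_upwards [self_mem_nhdsWithin] with s hs
  have hs' : t < s := hs
  rw [slope_def_module, Function.comp_apply, ← hP.add, ← Real.toNNReal_add (by linarith) ht,
    Real.coe_toNNReal _ (by linarith), sub_add_cancel]

/-- A continuous linear map intertwining the generator intertwines the semigroup. -/
theorem apply_comm_of_generator_comm (hP : IsQuantumMarkovSemigroup P) {T : Mat n →L[ℝ] Mat n}
    (hL : IsGenerator P T) (S : Mat n →L[ℝ] Mat n) (hS : ∀ x, T (S x) = S (T x)) (t : ℝ≥0)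
    (x : Mat n) : P t (S x) = S (P t x) := by
  -- Both curves solve the linear equation `f' = T f` with initial value `S x`.
  have h := ODE_solution_unique (v := fun _ => T) (K := ‖T‖₊)
    (f := fun s : ℝ => P s.toNNReal (S x)) (g := fun s : ℝ => S (P s.toNNReal x))
    (a := 0) (b := t) (fun _ => T.lipschitz) (continuous_orbit hP _).continuousOn
    (fun s hs => hasDerivWithinAt_orbit hP hL _ s hs.1)
    (S.continuous.comp (continuous_orbit hP x)).continuousOn
    (fun s hs => by
      rw [hS]
      exact S.hasFDerivAt.comp_hasDerivWithinAt s (hasDerivWithinAt_orbit hP hL x s hs.1))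
    (by simp [hP.zero])
  simpa using h (right_mem_Icc.2 t.2)

end Semigroup

end

/-! ### Invariant states, the conditional expectation and the transport bound -/

section

open Filter Set

variable {n : ℕ} {J : Type*}

theorem functional_apply (ρ x : Mat n) : functional ρ x = (ρ * x).trace := rfl

theorem preserves_iff {Φ : Mat n →CP Mat n} {ρ : Mat n} :
    Preserves Φ ρ ↔ ∀ x, (ρ * Φ x).trace = (ρ * x).trace := by
  rw [Preserves, LinearMap.ext_iff]
  rfl

theorem IsGNSSymmetric.preserves {P : ℝ≥0 → (Mat n →CP Mat n)} {σ : Mat n}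
    (hP : IsQuantumMarkovSemigroup P) (h : IsGNSSymmetric P σ) (t : ℝ≥0) : Preserves (P t) σ := by
  rw [preserves_iff]
  intro x
  simpa [functional_apply, hP.map_one] using h t 1 x

/-- The density of an invariant state relative to the reference state is a fixed point. -/
theorem IsGNSSymmetric.mul_inv_mem_invariantSubalgebra {P : ℝ≥0 → (Mat n →CP Mat n)}
    {σ₀ σ : Mat n} (hσ₀ : σ₀.PosDef) (hσ : σ.PosDef) (h : IsGNSSymmetric P σ₀)
    (hinv : ∀ t, Preserves (P t) σ) : σ * σ₀⁻¹ ∈ invariantSubalgebra P := by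
  intro t
  set k := σ * σ₀⁻¹ with hk
  have hdet := (Matrix.isUnit_iff_isUnit_det _).1 hσ₀.isUnit
  have hkσ : k * σ₀ = σ := by rw [hk, mul_assoc, Matrix.nonsing_inv_mul _ hdet, mul_one]
  have hσk : σ₀ * kᴴ = σ := by
    have := congrArg Matrix.conjTranspose hkσ
    rwa [Matrix.conjTranspose_mul, hσ₀.isHermitian.eq, hσ.isHermitian.eq] at this
  have hconj : ∀ y : Mat n, (σ₀ * (yᴴ * k)).trace = star (σ * y).trace := by
    intro y
    rw [← Matrix.trace_conjTranspose, Matrix.conjTranspose_mul, hσ.isHermitian.eq,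
      Matrix.trace_mul_comm, mul_assoc, hkσ]
  -- GNS symmetry moves `P_t` from `k` to `x`, where invariance of `σ` removes it.
  have key : ∀ x : Mat n, (σ₀ * (xᴴ * P t k)).trace = (σ₀ * (xᴴ * k)).trace := by
    intro x
    have h1 := h t x k
    rw [functional_apply, functional_apply, hconj, preserves_iff.1 (hinv t)] at h1
    rw [h1, hconj]
  have h2 : (σ₀ * ((P t k - k)ᴴ * (P t k - k))).trace = 0 := by
    rw [mul_sub, mul_sub, Matrix.trace_sub, key, sub_self]
  exact sub_eq_zero.1 (eq_zero_of_trace_mul_eq_zero hσ₀ h2)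

/-- Uniqueness of the state-preserving conditional expectation. -/
theorem IsConditionalExpectation.unique {N : Set (Mat n)} {σ : Mat n} (hσ : σ.PosDef)
    (hone : 1 ∈ N) (hsub : ∀ x ∈ N, ∀ y ∈ N, x - y ∈ N) (hstar : ∀ x ∈ N, xᴴ ∈ N)
    {E E' : Mat n →CP Mat n} (hE : IsConditionalExpectation N E) (hEσ : Preserves E σ)
    (hE' : IsConditionalExpectation N E') (hEσ' : Preserves E' σ) : E = E' := by
  -- Thus `E` is the GNS-orthogonal projection onto `N`: the difference of two candidates lies in
  -- `N` and is orthogonal to itself.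
  have key : ∀ {E : Mat n →CP Mat n}, IsConditionalExpectation N E → Preserves E σ →
      ∀ a ∈ N, ∀ x, (σ * (a * E x)).trace = (σ * (a * x)).trace := by
    intro E hE hEσ a ha x
    have := hE.map_mul_mul a ha 1 hone x
    rw [mul_one, mul_one] at this
    rw [← this, preserves_iff.1 hEσ]
  refine DFunLike.ext _ _ fun x => sub_eq_zero.1 (eq_zero_of_trace_mul_eq_zero hσ ?_)
  have hd := hstar _ (hsub _ (hE.map_mem x) _ (hE'.map_mem x))
  rw [mul_sub, mul_sub, Matrix.trace_sub, key hE hEσ _ hd, key hE' hEσ' _ hd, sub_self]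

/-- Write `σ = k σ₀` with `k` commuting with each `v_j`; passing `v_j` through `k` costs no factor,
so the frequencies are unchanged. -/
theorem IsModularFamily.of_commute {σ₀ σ : Mat n} {v : J → Mat n} {ω : J → ℝ}
    (hσ₀ : σ₀.PosDef) (h : IsModularFamily σ₀ v ω)
    (hc : ∀ j, partialDer v j (σ * σ₀⁻¹) = 0) : IsModularFamily σ v ω := by
  refine ⟨h.adjoint_closed, fun j => ?_⟩
  have hdet := (Matrix.isUnit_iff_isUnit_det _).1 hσ₀.isUnit
  have hk : σ * σ₀⁻¹ * σ₀ = σ := by rw [mul_assoc, Matrix.nonsing_inv_mul _ hdet, mul_one]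
  have hj := sub_eq_zero.1 (hc j)
  generalize σ * σ₀⁻¹ = k at hk hj
  rw [← hk, mul_assoc, h.mul_eq j, mul_smul_comm, ← mul_assoc, ← mul_assoc, hj]

theorem IsLindbladForm.isModularFamily [Fintype J] {P : ℝ≥0 → (Mat n →CP Mat n)} {σ : Mat n}
    {v : J → Mat n} {ω : J → ℝ} (hσ : σ.PosDef) (h : IsLindbladForm P σ v ω) :
    IsModularFamily σ v ω :=
  ⟨h.adjoint_closed, fun j => mul_eq_of_modular hσ (h.modular j)⟩

section GradientEstimate

variable [Fintype J] {P : ℝ≥0 → (Mat n →CP Mat n)} {v : J → Mat n} {ω : J → ℝ} {C κ : ℝ}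

theorem map_mul_mul_of_partialDer_eq_zero (hP : IsQuantumMarkovSemigroup P)
    (hL : IsGenerator P (lindbladian v ω)) (hv : ∃ π : Equiv.Perm J, ∀ j, v (π j) = (v j)ᴴ)
    {a b : Mat n} (ha : ∀ j, partialDer v j a = 0) (hb : ∀ j, partialDer v j b = 0) (t : ℝ≥0)
    (x : Mat n) : P t (a * x * b) = a * P t x * b := by
  obtain ⟨T, hT⟩ := exists_continuousLinearMap_lindbladian v ω
  rw [← funext hT] at hL
  refine apply_comm_of_generator_comm hP hL
    (LinearMap.toContinuousLinearMap
      ((LinearMap.mulRight ℝ b).comp (LinearMap.mulLeft ℝ a))) (fun y => ?_) t x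
  simp only [LinearMap.coe_toContinuousLinearMap', LinearMap.comp_apply, LinearMap.mulLeft_apply,
    LinearMap.mulRight_apply, hT]
  exact lindbladian_mul_mul ω ha hb (conjTranspose_mul_comm_of_partialDer_eq_zero hv ha)
    (conjTranspose_mul_comm_of_partialDer_eq_zero hv hb) y

theorem tendsto_mul_exp_neg_mul (hκ : 0 < κ) (a b : ℝ) :
    Tendsto (fun k : ℕ => a * Real.exp (-κ * k) * b) atTop (𝓝 0) := by
  have h1 : Tendsto (fun k : ℕ => -κ * (k : ℝ)) atTop atBot :=
    tendsto_natCast_atTop_atTop.const_mul_atTop_of_neg (neg_lt_zero.2 hκ)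
  simpa using ((Real.tendsto_exp_atBot.comp h1).const_mul a).mul_const b

theorem continuous_lipNorm (v : J → Mat n) : Continuous (lipNorm v) := by
  unfold lipNorm partialDer
  fun_prop

/-- For a fixed point the gradient estimate reads `lipNorm x ≤ C e^{-κt} lipNorm x`, and `t → ∞`
kills the gradient. Conversely, an element of the commutant factors out of `P_t (x * 1)`. -/
theorem mem_invariantSubalgebra_iff (hP : IsQuantumMarkovSemigroup P)
    (hL : IsGenerator P (lindbladian v ω)) (hv : ∃ π : Equiv.Perm J, ∀ j, v (π j) = (v j)ᴴ)
    (hκ : 0 < κ) (hgrad : ∀ (t : ℝ≥0) (x : Mat n),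
      lipNorm v (P t x) ≤ C * Real.exp (-κ * t) * lipNorm v x) (x : Mat n) :
    x ∈ invariantSubalgebra P ↔ ∀ j, partialDer v j x = 0 := by
  refine ⟨fun hx => (lipNorm_eq_zero_iff v x).1 (le_antisymm ?_ (lipNorm_nonneg v x)),
    fun hx t => ?_⟩
  · refine ge_of_tendsto' (tendsto_mul_exp_neg_mul hκ C (lipNorm v x)) fun k => ?_
    simpa [hx (k : ℝ≥0)] using hgrad k x
  · simpa [hP.map_one] using
      map_mul_mul_of_partialDer_eq_zero hP hL hv hx (b := 1) (fun j => by simp [partialDer]) t 1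

/-- Orbits have exponentially decaying velocity, hence converge; the limit has zero gradient, so it
lies in `𝓝`. The remaining properties hold for each `P_t` and pass to the limit. -/
theorem exists_conditionalExpectation (hP : IsQuantumMarkovSemigroup P) {σ₀ : Mat n}
    (hσ₀ : σ₀.PosDef) (hsym : IsGNSSymmetric P σ₀) (hform : IsLindbladForm P σ₀ v ω)
    (hC : 0 < C) (hκ : 0 < κ) (hgrad : ∀ (t : ℝ≥0) (x : Mat n),
      lipNorm v (P t x) ≤ C * Real.exp (-κ * t) * lipNorm v x) :
    ∃ E : Mat n →CP Mat n, IsConditionalExpectation (invariantSubalgebra P) E ∧ Preserves E σ₀ ∧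
      ∀ x, Tendsto (fun k : ℕ => P k x) atTop (𝓝 (E x)) := by
  have hmem := mem_invariantSubalgebra_iff hP hform.generator hform.adjoint_closed hκ hgrad
  obtain ⟨K, hK, hKL⟩ := (hform.isModularFamily hσ₀).norm_lindbladian_le hσ₀
  obtain ⟨E, hE⟩ := exists_completelyPositiveMap_of_tendsto (Φ := fun k : ℕ => P k) fun x => by
    obtain ⟨y, hy⟩ := exists_tendsto_of_norm_deriv_right_le_exp
      (f := fun s : ℝ => P s.toNNReal x) (A := K * C * lipNorm v x) hκ
      (mul_nonneg (mul_nonneg hK hC.le) (lipNorm_nonneg v x)) (continuous_orbit hP x).continuousOn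
      (hasDerivWithinAt_orbit hP hform.generator x) fun t ht => by
        have h1 := hgrad t.toNNReal x
        rw [Real.coe_toNNReal _ ht] at h1
        refine (hKL _).trans ((mul_le_mul_of_nonneg_left h1 hK).trans_eq ?_)
        ring
    refine ⟨y, ?_⟩
    simpa [Function.comp_def] using hy.comp tendsto_natCast_atTop_atTop
  refine ⟨E, ⟨?_, fun x => ?_, fun x hx => ?_, fun a ha b hb x => ?_⟩, ?_, hE⟩
  · exact tendsto_nhds_unique (hE 1) (by simp [hP.map_one])
  · refine (hmem _).2 ((lipNorm_eq_zero_iff v _).1 (le_antisymm ?_ (lipNorm_nonneg v _)))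
    exact le_of_tendsto_of_tendsto' (((continuous_lipNorm v).tendsto _).comp (hE x))
      (tendsto_mul_exp_neg_mul hκ C (lipNorm v x)) fun k => by simpa using hgrad k x
  · exact tendsto_nhds_unique (hE x) (by simp [hx _])
  · refine tendsto_nhds_unique (hE _) ?_
    simp only [map_mul_mul_of_partialDer_eq_zero hP hform.generator hform.adjoint_closed
      ((hmem a).1 ha) ((hmem b).1 hb)]
    exact ((hE x).const_mul a).mul_const b
  · refine preserves_iff.2 fun x => tendsto_nhds_unique
      (((LinearMap.toContinuousLinearMap (functional σ₀)).continuous.tendsto _).comp (hE x)) ?_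
    simp [Function.comp_def, functional_apply, preserves_iff.1 (hsym.preserves hP _)]

theorem re_functional_sub_le (hP : IsQuantumMarkovSemigroup P) {σ : Mat n} (hσ : σ.PosDef)
    (hL : IsGenerator P (lindbladian v ω)) (hfam : IsModularFamily σ v ω)
    (hC : 0 < C) (hκ : 0 < κ) (hgrad : ∀ (t : ℝ≥0) (x : Mat n),
      lipNorm v (P t x) ≤ C * Real.exp (-κ * t) * lipNorm v x)
    {ρ : Mat n} (hρ : IsDensity ρ) {x y : Mat n} (hx : lipNorm v x ≤ 1)
    (hy : Tendsto (fun k : ℕ => P k x) atTop (𝓝 y)) :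
    (functional ρ x - functional ρ y).re ≤
      C / κ * (⨆ i, (Real.exp (-ω i / 4) + Real.exp (ω i / 4))) *
        √(dirichletForm (lindbladian v ω) σ (gammaPow σ (-1 / 2) (CFC.sqrt ρ))) := by
  set R := (⨆ i, (Real.exp (-ω i / 4) + Real.exp (ω i / 4))) *
    √(dirichletForm (lindbladian v ω) σ (gammaPow σ (-1 / 2) (CFC.sqrt ρ))) with hR
  have hR0 : 0 ≤ R := mul_nonneg (Real.iSup_nonneg fun i => by positivity) (Real.sqrt_nonneg _)
  let F : Mat n →L[ℝ] ℂ := (LinearMap.toContinuousLinearMap (functional ρ)).restrictScalars ℝ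
  have hF : ∀ z, F z = functional ρ z := fun z => rfl
  have hbound : ∀ k : ℕ, ‖F (P k x) - F x‖ ≤ R * C / κ := by
    intro k
    have h1 := norm_sub_le_of_norm_deriv_right_le_exp (f := fun s : ℝ => F (P s.toNNReal x))
      (f' := fun s => F (lindbladian v ω (P s.toNNReal x))) (A := R * C) hκ
      (F.continuous.comp (continuous_orbit hP x)).continuousOn
      (fun t ht => F.hasFDerivAt.comp_hasDerivWithinAt t (hasDerivWithinAt_orbit hP hL x t ht))
      (fun t ht => by
        have h1 := hgrad t.toNNReal x
        rw [Real.coe_toNNReal _ ht] at h1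
        refine (hfam.norm_trace_mul_lindbladian_le hσ hρ _).trans ?_
        rw [mul_assoc R]
        refine mul_le_mul_of_nonneg_left (h1.trans ?_) hR0
        exact mul_le_of_le_one_right (by positivity) hx)
      le_rfl (Nat.cast_nonneg k)
    simp only [Real.toNNReal_natCast, Real.toNNReal_zero, hP.zero, mul_zero, Real.exp_zero] at h1
    refine h1.trans (mul_le_of_le_one_right (by positivity) ?_)
    linarith [Real.exp_pos (-κ * k)]
  have hlim : Tendsto (fun k : ℕ => ‖F (P k x) - F x‖) atTop (𝓝 ‖F y - F x‖) :=
    (((F.continuous.tendsto y).comp hy).sub_const (F x)).norm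
  have h2 : ‖F y - F x‖ ≤ R * C / κ := le_of_tendsto' hlim hbound
  rw [norm_sub_rev] at h2
  calc _ ≤ ‖F x - F y‖ := Complex.re_le_norm _
    _ ≤ R * C / κ := h2
    _ = _ := by rw [hR]; ring

end GradientEstimate

end

end QuantumTransport

open QuantumTransport in
theorem mainTheorem3 {n : ℕ} {J : Type*} [Fintype J]
    (P : ℝ≥0 → (Mat n →CP Mat n)) (hP : IsQuantumMarkovSemigroup P)
    (σ₀ : Mat n) (hσ₀ : IsFaithfulDensity σ₀) (hsym : IsGNSSymmetric P σ₀)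
    (v : J → Mat n) (ω : J → ℝ) (hform : IsLindbladForm P σ₀ v ω)
    (C κ : ℝ) (hC : 0 < C) (hκ : 0 < κ)
    (hgrad : ∀ (t : ℝ≥0) (x : Mat n),
      lipNorm v (P t x) ≤ C * Real.exp (-κ * t) * lipNorm v x) :
    (∃! E : Mat n →CP Mat n,
      IsConditionalExpectation (invariantSubalgebra P) E ∧ Preserves E σ₀) ∧
    ∀ E : Mat n →CP Mat n,
      IsConditionalExpectation (invariantSubalgebra P) E → Preserves E σ₀ →
      ∀ ρ : Mat n, IsDensity ρ →
      ∀ σ : Mat n, IsFaithfulDensity σ → (∀ t, Preserves (P t) σ) →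
        wassersteinOne v (functional ρ) (functional ρ ∘ₗ E.toLinearMap) ≤
          ((C / κ * (⨆ i, (Real.exp (-ω i / 4) + Real.exp (ω i / 4))) *
            √(dirichletForm (lindbladian v ω) σ (gammaPow σ (-1 / 2) (CFC.sqrt ρ))) : ℝ) :
              EReal) := by
  have hmem := mem_invariantSubalgebra_iff hP hform.generator hform.adjoint_closed hκ hgrad
  have hone : 1 ∈ invariantSubalgebra P := fun t => hP.map_one t
  have hsub : ∀ x ∈ invariantSubalgebra P, ∀ y ∈ invariantSubalgebra P,
      x - y ∈ invariantSubalgebra P := fun x hx y hy t => by rw [map_sub, hx t, hy t]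
  have hstar : ∀ x ∈ invariantSubalgebra P, xᴴ ∈ invariantSubalgebra P := fun x hx =>
    (hmem _).2 (partialDer_conjTranspose_eq_zero hform.adjoint_closed ((hmem x).1 hx))
  obtain ⟨E₀, hE₀, hE₀σ, hlim⟩ :=
    exists_conditionalExpectation hP hσ₀.posDef hsym hform hC hκ hgrad
  refine ⟨⟨E₀, ⟨hE₀, hE₀σ⟩, fun E hE =>
    hE.1.unique hσ₀.posDef hone hsub hstar hE.2 hE₀ hE₀σ⟩, ?_⟩
  intro E hE hEσ ρ hρ σ hσ hinv
  -- Uniqueness identifies the given expectation with the limit of `P_t`, which the integration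
  -- along orbits requires.
  obtain rfl := hE.unique hσ₀.posDef hone hsub hstar hEσ hE₀ hE₀σ
  have hfam := (hform.isModularFamily hσ₀.posDef).of_commute hσ₀.posDef
    ((hmem _).1 (hsym.mul_inv_mem_invariantSubalgebra hσ₀.posDef hσ.posDef hinv))
  refine iSup₂_le fun x hx => EReal.coe_le_coe_iff.2 ?_
  exact re_functional_sub_le hP hσ.posDef hform.generator hfam hC hκ hgrad hρ hx.2 (hlim x)
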